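/- All graphs are finite and simple. For a graph $G$, let $\chi(G)$ be its chromatic number and $\chi_\ell(G)$ its list chromatic number, i.e. the smallest $k$ such that, whenever each vertex $v$ of $G$ is given a set $L(v)$ of exactly $k$ colors, $G$ has a proper coloring $f$ with $f(v)\in L(v)$ for every vertex $v$. Let $K_n\vee G$ denote the join of the complete graph $K_n$ and $G$ (with $K_0\vee G=G$), in which every vertex of $K_n$ is adjacent to every vertex of $G$. For integers $s\ge 0$ and $1\le a\le b$, let $\tau_s(a,b)$ be the smallest integer $n\ge 0$ such that $\chi_\ell(K_n\vee K_{a,b})-\chi(K_n\vee K_{a,b})\le s$, where $K_{a,b}$ is the complete bipartite graph with partite sets of sizes $a$ and $b$ (such an $n$ always exists). **Theorem.** Let $s$, $l$, $a$ be nonnegative integers such that $l\ge 2$, $a>s+2$, and $a-s-1$ does not divide $l+s+1$. Let $$q=\left\lfloor\frac{l+s+1}{a-s-1}\right\rfloor,\qquad u=\bigl((1+q)(a-s-1)-(l+s+1)\bigr)q.$$ If $b$ is an integer with $b\ge a$ and $$b\ \ge\ (l+s+1)^s\left(\binom{l+s+1}{l+1}+\binom{l+s+1}{l}(q+1)-\binom{u}{l}\right),$$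 where $\binom{u}{l}=0$ if $u<l$, then $\tau_s(a,b)\ge l$. -/

import Mathlib

namespace SimpleGraph

/-- The join `G ∨ H`: the disjoint union of `G` and `H` together with all edges between a vertex
of `G` and a vertex of `H`. -/
def graphJoin {V W : Type*} (G : SimpleGraph V) (H : SimpleGraph W) : SimpleGraph (V ⊕ W) :=
  (G ⊕g H) ⊔ completeBipartiteGraph V W

/-- `L` is a `k`-assignment: every vertex receives a list (a set) of exactly `k` colors. -/
def IsListAssignment {V α : Type*} (L : V → Finset α) (k : ℕ) : Prop :=
  ∀ v, (L v).card = k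

/-- `G` is `L`-colorable: it has a proper coloring taking the color of each `v` from `L v`. -/
def ListColorable {V α : Type*} (G : SimpleGraph V) (L : V → Finset α) : Prop :=
  ∃ f : G.Coloring α, ∀ v, f v ∈ L v

/-- `G` is `L`-colorable whenever `L` is a `k`-assignment for `G`. -/
def ColorableFromLists {V : Type*} (G : SimpleGraph V) (k : ℕ) : Prop :=
  ∀ (α : Type) (L : V → Finset α), IsListAssignment L k → G.ListColorable L

/-- The list chromatic number: the smallest `k` such that `G` is `L`-colorable for every
`k`-assignment `L`. It is `ℕ∞`-valued, like `SimpleGraph.chromaticNumber`; both are finite when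
`G` is finite. -/
noncomputable def listChromaticNumber {V : Type*} (G : SimpleGraph V) : ℕ∞ :=
  ⨅ k ∈ {k : ℕ | G.ColorableFromLists k}, (k : ℕ∞)

/-- The `s`-th generalized Ohba number of a finite graph `G`: the smallest `n ≥ 0` such that the
list chromatic number of `K_n ∨ G` exceeds its chromatic number by at most `s`. (For `n = 0` the
graph `K_n ∨ G` is a copy of `G`; for `s = 0` this is the Ohba number of `G`.) -/
noncomputable def generalizedOhbaNumber {V : Type*} (s : ℕ) (G : SimpleGraph V) : ℕ :=
  sInf {n : ℕ |
    ((completeGraph (Fin n)).graphJoin G).listChromaticNumber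
      - ((completeGraph (Fin n)).graphJoin G).chromaticNumber ≤ (s : ℕ∞)}

end SimpleGraph

/-- `τ_s(a,b)`: the `s`-th generalized Ohba number of the complete bipartite graph `K_{a,b}`. -/
noncomputable def ohbaTau (s a b : ℕ) : ℕ :=
  (completeBipartiteGraph (Fin a) (Fin b)).generalizedOhbaNumber s

/-! Put `n = l - 1`, `k = l + s + 1`, `m = a - s - 1`. As `K_n ∨ K_{a,b}` has chromatic number `l +
1`, it suffices that it is not `k`-choosable; smaller `n` follow because a dominating vertex raises
the list chromatic number by at most one.

Bad lists (`exists_mem_largeSideBase_subset`): the clique and one small-side vertex get the `k` base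
colors, and so use a set `S` of `l` of them. Let `c₀` be the color of that vertex. For each residue
mod `m`, another small-side vertex has its base colors of that residue replaced by new ones; the one
for the residue of `c₀` must use a new color or a base color outside `S`. The last `s` vertices use
private colors, in `k ^ s` ways. Every outcome kills a `k`-list given to some large-side vertex. The
subtracted binomial counts outcomes that cannot occur: if `S` lies in the short residue classes, the
new color of index `q = k / m` is unavailable.

A Hall violator argument shows that the set defining `τ` is nonempty. -/

namespace SimpleGraph

/-! ### Colorings of joins. -/

section Join

variable {V W α : Type*} {G : SimpleGraph V} {H : SimpleGraph W}

@[simp] lemma graphJoin_adj_inl_inl {v w : V} :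
    (G.graphJoin H).Adj (Sum.inl v) (Sum.inl w) ↔ G.Adj v w := by
  simp [graphJoin]

@[simp] lemma graphJoin_adj_inr_inr {v w : W} :
    (G.graphJoin H).Adj (Sum.inr v) (Sum.inr w) ↔ H.Adj v w := by
  simp [graphJoin]

@[simp] lemma graphJoin_adj_inl_inr {v : V} {w : W} :
    (G.graphJoin H).Adj (Sum.inl v) (Sum.inr w) := by
  simp [graphJoin]

@[simp] lemma graphJoin_adj_inr_inl {v : V} {w : W} :
    (G.graphJoin H).Adj (Sum.inr w) (Sum.inl v) := by
  simp [graphJoin]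

/-- A proper coloring of `K_V ∨ G` is an injective coloring of `V` together with a proper coloring
of `G` using other colors. -/
lemma listColorable_completeGraph_graphJoin_iff {L : V ⊕ W → Finset α} :
    ((completeGraph V).graphJoin H).ListColorable L ↔
      ∃ (g : V → α) (h : H.Coloring α), Function.Injective g ∧ (∀ v w, g v ≠ h w) ∧
        (∀ v, g v ∈ L (Sum.inl v)) ∧ ∀ w, h w ∈ L (Sum.inr w) := by
  constructor
  · rintro ⟨f, hf⟩
    refine ⟨fun v => f (Sum.inl v), Coloring.mk (fun w => f (Sum.inr w)) fun {v w} h => ?_, ?_,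
      fun v w => f.valid graphJoin_adj_inl_inr, fun v => hf _, fun w => hf _⟩
    · exact f.valid (graphJoin_adj_inr_inr.2 h)
    · intro v w h
      by_contra hne
      exact f.valid (graphJoin_adj_inl_inl.2 (by simpa using hne)) h
  · rintro ⟨g, h, hg, hgh, hgL, hhL⟩
    refine ⟨Coloring.mk (Sum.elim g h) ?_, ?_⟩
    · rintro (v | v) (w | w) hvw
      · exact fun e => (graphJoin_adj_inl_inl.1 hvw).ne (hg e)
      · exact hgh v w
      · exact (hgh w v).symm
      · exact h.valid (graphJoin_adj_inr_inr.1 hvw)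
    · rintro (v | v)
      · exact hgL v
      · exact hhL v

end Join

/-! ### Monotonicity of choosability, and dominating vertices. -/

section ListColoring

variable {V W α : Type*} {G : SimpleGraph V} {H : SimpleGraph W}

lemma ListColorable.mono {L L' : V → Finset α} (h : G.ListColorable L) (hL : ∀ v, L v ⊆ L' v) :
    G.ListColorable L' :=
  let ⟨f, hf⟩ := h; ⟨f, fun v => hL v (hf v)⟩

lemma ColorableFromLists.listColorable_of_le_card {α : Type} {k : ℕ} (h : G.ColorableFromLists k)
    {L : V → Finset α} (hL : ∀ v, k ≤ (L v).card) : G.ListColorable L := by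
  choose L' hL' hcard using fun v => Finset.exists_subset_card_eq (hL v)
  exact (h α L' hcard).mono hL'

lemma ColorableFromLists.mono {k k' : ℕ} (h : G.ColorableFromLists k) (hk : k ≤ k') :
    G.ColorableFromLists k' :=
  fun _ _ hL => h.listColorable_of_le_card fun v => (hL v).symm ▸ hk

lemma listChromaticNumber_le_coe_iff {k : ℕ} :
    G.listChromaticNumber ≤ k ↔ G.ColorableFromLists k := by
  refine ⟨fun h => ?_, fun h => iInf₂_le k h⟩
  by_contra hk
  have : ((k + 1 : ℕ) : ℕ∞) ≤ G.listChromaticNumber := by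
    refine le_iInf₂ fun j hj => ?_
    by_contra hlt
    exact hk (ColorableFromLists.mono hj (by
      rw [Nat.cast_le, not_le] at hlt
      omega))
  exact absurd (Nat.cast_le.1 (this.trans h)) (by omega)

/-- Adding a dominating vertex raises the list size needed by at most one. -/
lemma ColorableFromLists.completeGraph_succ_graphJoin {n k : ℕ}
    (h : ((completeGraph (Fin n)).graphJoin H).ColorableFromLists k) :
    ((completeGraph (Fin (n + 1))).graphJoin H).ColorableFromLists (k + 1) := by
  classical
  intro α L hL
  obtain ⟨c, hc⟩ : (L (Sum.inl 0)).Nonempty := by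
    rw [← Finset.card_pos, hL]; omega
  -- Give the new vertex the color `c` and delete `c` from all other lists, which shrink by at most
  -- one.
  have h' := h.listColorable_of_le_card
    (L := fun x => (L (Sum.map Fin.succ id x)).erase c) fun v => by
      have := Finset.pred_card_le_card_erase (s := L (Sum.map Fin.succ id v)) (a := c)
      rw [hL] at this
      simpa using this
  rw [listColorable_completeGraph_graphJoin_iff] at h' ⊢
  obtain ⟨g, f, hg, hgf, hgL, hfL⟩ := h'
  simp only [Finset.mem_erase] at hgL hfL
  refine ⟨Fin.cons c g, f, ?_, ?_, ?_, fun w => (hfL w).2⟩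
  · rw [Fin.cons_injective_iff]
    exact ⟨fun ⟨i, hi⟩ => (hgL i).1 hi, hg⟩
  · intro v w
    refine Fin.cases ?_ (fun i => ?_) v
    · simpa using (hfL w).1.symm
    · simpa using hgf i w
  · intro v
    refine Fin.cases ?_ (fun i => ?_) v
    · simpa using hc
    · simpa using (hgL i).2

lemma ColorableFromLists.completeGraph_add_graphJoin {n k : ℕ}
    (h : ((completeGraph (Fin n)).graphJoin H).ColorableFromLists k) (j : ℕ) :
    ((completeGraph (Fin (n + j))).graphJoin H).ColorableFromLists (k + j) := by
  induction j with
  | zero => exact h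
  | succ j ih => exact ih.completeGraph_succ_graphJoin

end ListColoring

/-! ### Chromatic number of the join. -/

section Chromatic

/-- `K_n ∨ K_{V,W}` is `(n + 2)`-chromatic. -/
lemma chromaticNumber_completeGraph_graphJoin_completeBipartiteGraph (n : ℕ) (V W : Type*)
    [Nonempty V] [Nonempty W] :
    ((completeGraph (Fin n)).graphJoin (completeBipartiteGraph V W)).chromaticNumber
      = (n + 2 : ℕ) := by
  apply le_antisymm
  · let f : ((completeGraph (Fin n)).graphJoin (completeBipartiteGraph V W)).Coloring
        (Fin n ⊕ Bool) :=
      Coloring.mk (Sum.elim Sum.inl fun x => Sum.inr x.isLeft) (by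
        rintro (v | v | v) (w | w | w) h <;> simp_all)
    simpa using f.colorable.chromaticNumber_le
  · obtain ⟨v⟩ := ‹Nonempty V›
    obtain ⟨w⟩ := ‹Nonempty W›
    refine le_chromaticNumber_of_pairwise_adj (ι := Fin n ⊕ Bool) (by simp)
      (Sum.elim Sum.inl fun x => Sum.inr (if x then Sum.inl v else Sum.inr w)) ?_
    rintro (i | i) (j | j) hij
    · simpa using hij
    · simp
    · simp
    · cases i <;> cases j <;> simp_all

end Chromatic

end SimpleGraph

namespace SimpleGraph

/-! ### Chromatic-choosability for large `n`, via Hall's theorem. -/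

section Hall

variable {V W α : Type*} [DecidableEq α]

/-- A system of distinct representatives exists if each list is at least as large as the family. -/
lemma exists_injective_of_card_le {ι : Type*} [Fintype ι] (L : ι → Finset α)
    (h : ∀ i, Fintype.card ι ≤ (L i).card) : ∃ f : ι → α, Function.Injective f ∧ ∀ i, f i ∈ L i := by
  refine (Finset.all_card_le_biUnion_card_iff_exists_injective L).1 fun s => ?_
  rcases s.eq_empty_or_nonempty with rfl | ⟨i, hi⟩
  · simp
  · exact (Finset.card_le_univ s).trans
      ((h i).trans (Finset.card_le_card (Finset.subset_biUnion_of_mem L hi)))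

/-- Either a family of finite sets has a system of distinct representatives, or there is a
violator `X` of Hall's condition such that the sets indexed by the complement of `X` have distinct
representatives avoiding the union over `X`. -/
lemma exists_hall_violator {ι : Type*} [Fintype ι] [DecidableEq ι] (L : ι → Finset α) :
    ∃ X : Finset ι, (X = ∅ ∨ (X.biUnion L).card < X.card) ∧
      ∃ f : {i // i ∉ X} → α, Function.Injective f ∧ ∀ i : {i // i ∉ X}, f i ∈ L i \ X.biUnion L := by
  have hne : ((Finset.univ : Finset (Finset ι)).filter
      fun X => X = ∅ ∨ (X.biUnion L).card < X.card).Nonempty := ⟨∅, by simp⟩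
  -- Take `X` of maximum size: a Hall violator among the reduced lists outside `X` could be added to
  -- `X`.
  obtain ⟨X, hX, hmax⟩ := Finset.exists_max_image _ Finset.card hne
  simp only [Finset.mem_filter, Finset.mem_univ, true_and] at hX hmax
  refine ⟨X, hX, ?_⟩
  refine (Finset.all_card_le_biUnion_card_iff_exists_injective
    (fun i : {i // i ∉ X} => L i \ X.biUnion L)).1 fun s => ?_
  by_contra! hs
  set Y := s.map (Function.Embedding.subtype _) with hY
  have hdisj : Disjoint X Y := by
    rw [Finset.disjoint_left]
    intro i hi hiY
    obtain ⟨j, -, rfl⟩ := Finset.mem_map.1 hiY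
    exact j.2 hi
  have hcard : (X ∪ Y).card = X.card + s.card := by
    rw [Finset.card_union_of_disjoint hdisj, hY, Finset.card_map]
  have hsub : (X ∪ Y).biUnion L ⊆
      X.biUnion L ∪ s.biUnion (fun i : {i // i ∉ X} => L i \ X.biUnion L) := by
    intro c hc
    by_cases hcX : c ∈ X.biUnion L
    · exact Finset.mem_union_left _ hcX
    · obtain ⟨i, hi, hci⟩ := Finset.mem_biUnion.1 hc
      rcases Finset.mem_union.1 hi with hi | hi
      · exact absurd (Finset.mem_biUnion.2 ⟨i, hi, hci⟩) hcX
      · obtain ⟨j, hj, rfl⟩ := Finset.mem_map.1 hi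
        exact Finset.mem_union_right _
          (Finset.mem_biUnion.2 ⟨j, hj, Finset.mem_sdiff.2 ⟨hci, hcX⟩⟩)
  have hle := (Finset.card_le_card hsub).trans (Finset.card_union_le _ _)
  have hXle : (X.biUnion L).card ≤ X.card := by
    rcases hX with rfl | hX
    · simp
    · exact hX.le
  have := hmax (X ∪ Y) (Or.inr (by omega))
  omega

/-- Few large subsets of a set `U` have many common elements. -/
lemma le_card_filter_forall_mem {ι : Type*} (s : Finset ι) (L : ι → Finset α) (U : Finset α)
    (d : ℕ) (h : ∀ i ∈ s, (U \ L i).card ≤ d) :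
    U.card - s.card * d ≤ (U.filter fun c => ∀ i ∈ s, c ∈ L i).card := by
  have hsub : U ⊆ (U.filter fun c => ∀ i ∈ s, c ∈ L i) ∪ s.biUnion fun i => U \ L i := by
    intro c hc
    by_cases hcs : ∀ i ∈ s, c ∈ L i
    · exact Finset.mem_union_left _ (Finset.mem_filter.2 ⟨hc, hcs⟩)
    · push Not at hcs
      obtain ⟨i, hi, hci⟩ := hcs
      exact Finset.mem_union_right _ (Finset.mem_biUnion.2 ⟨i, hi, Finset.mem_sdiff.2 ⟨hc, hci⟩⟩)
  have h1 := (Finset.card_le_card hsub).trans (Finset.card_union_le _ _)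
  have h2 := Finset.card_biUnion_le_card_mul s (fun i => U \ L i) d h
  omega

/-- Joined with a large complete graph, a complete bipartite graph is chromatic-choosable. -/
lemma colorableFromLists_completeGraph_graphJoin_completeBipartiteGraph (n : ℕ)
    (V W : Type*) [Fintype V] [Fintype W]
    (hn : (Fintype.card V + Fintype.card W) ^ 2 ≤ n) :
    ((completeGraph (Fin n)).graphJoin (completeBipartiteGraph V W)).ColorableFromLists
      (n + 2) := by
  classical
  intro α L hL
  obtain ⟨X, hX, f, hf, hfL⟩ := exists_hall_violator L
  set N := X.biUnion L with hN
  -- Since `N` has fewer colors than `X` has vertices, each list in `X` is almost all of `N`. Hence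
  -- each partite set within `X` can be colored with one color, and the clique lists keep `n` other
  -- colors.
  have key : ∃ h : {x // x ∈ X} → α, (∀ x : {x // x ∈ X}, h x ∈ L x) ∧ ∀ x y : {x // x ∈ X},
      ((completeGraph (Fin n)).graphJoin (completeBipartiteGraph V W)).Adj x y → h x ≠ h y := by
    rcases hX with rfl | hX
    · exact ⟨fun x => absurd x.2 (Finset.notMem_empty _), fun x => absurd x.2 (Finset.notMem_empty _),
        fun x => absurd x.2 (Finset.notMem_empty _)⟩
    obtain ⟨x₀, hx₀⟩ : X.Nonempty := Finset.card_pos.1 (by omega)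
    have hLN : ∀ x ∈ X, L x ⊆ N := fun x hx => Finset.subset_biUnion_of_mem L hx
    have hNlow : n + 2 ≤ N.card := hL x₀ ▸ Finset.card_le_card (hLN x₀ hx₀)
    have hNup : N.card ≤ n + (Fintype.card V + Fintype.card W) := by
      have := Finset.card_le_univ X
      simp only [Fintype.card_sum, Fintype.card_fin] at this
      omega
    have common : ∀ s ⊆ X, s.card ≤ Fintype.card V + Fintype.card W →
        1 < (N.filter fun c => ∀ x ∈ s, c ∈ L x).card := by
      intro s hs hcard
      have h1 := le_card_filter_forall_mem s L N (Fintype.card V + Fintype.card W)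
        fun x hx => by
          rw [Finset.card_sdiff_of_subset (hLN x (hs hx)), hL]
          -- Fewer than `|V| + |W|` colors are missed by each list, so `|N| ≥ n + 2` and the bound
          -- on `n` leave at least two common colors.
          omega
      have h2 := Nat.mul_le_mul_right (Fintype.card V + Fintype.card W) hcard
      rw [← sq] at h2
      refine lt_of_lt_of_le ?_ (h1.trans_eq (by congr))
      omega
    have cardV : (X.filter fun x => ∃ v, x = Sum.inr (Sum.inl v)).card ≤ Fintype.card V := by
      refine (Finset.card_le_card (t := Finset.univ.image fun v => Sum.inr (Sum.inl v)) ?_).trans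
        Finset.card_image_le
      intro x
      simp only [Finset.mem_filter, Finset.mem_image, Finset.mem_univ, true_and]
      rintro ⟨-, v, rfl⟩
      exact ⟨v, rfl⟩
    have cardW : (X.filter fun x => ∃ w, x = Sum.inr (Sum.inr w)).card ≤ Fintype.card W := by
      refine (Finset.card_le_card (t := Finset.univ.image fun w => Sum.inr (Sum.inr w)) ?_).trans
        Finset.card_image_le
      intro x
      simp only [Finset.mem_filter, Finset.mem_image, Finset.mem_univ, true_and]
      rintro ⟨-, w, rfl⟩
      exact ⟨w, rfl⟩
    obtain ⟨c₁, hc₁⟩ := Finset.card_pos.1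
      (zero_lt_one.trans (common _ (Finset.filter_subset _ _) (cardV.trans (Nat.le_add_right _ _))))
    obtain ⟨c₂, hc₂, hne⟩ := Finset.exists_mem_ne
      (common _ (Finset.filter_subset _ _) (cardW.trans (Nat.le_add_left _ _))) c₁
    simp only [Finset.mem_filter] at hc₁ hc₂
    obtain ⟨g, hg, hgL⟩ := exists_injective_of_card_le
      (fun i : {i : Fin n // Sum.inl i ∈ X} => L (Sum.inl i.1) \ {c₁, c₂}) fun i => by
        have h1 := Finset.le_card_sdiff {c₁, c₂} (L (Sum.inl i.1))
        have h2 : Fintype.card {i : Fin n // Sum.inl i ∈ X} ≤ n := by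
          simpa using Fintype.card_subtype_le fun i : Fin n => Sum.inl i ∈ X
        have h3 := Finset.card_le_two (a := c₁) (b := c₂)
        rw [hL] at h1
        omega
    simp only [Finset.mem_sdiff, Finset.mem_insert, Finset.mem_singleton, not_or] at hgL
    refine ⟨fun x => match x with
      | ⟨Sum.inl i, hi⟩ => g ⟨i, hi⟩
      | ⟨Sum.inr (Sum.inl _), _⟩ => c₁
      | ⟨Sum.inr (Sum.inr _), _⟩ => c₂, ?_, ?_⟩
    · rintro ⟨(i | v | w), hx⟩
      · exact (hgL _).1
      · exact hc₁.2 _ ⟨hx, v, rfl⟩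
      · exact hc₂.2 _ ⟨hx, w, rfl⟩
    · rintro ⟨(i | v | w), hx⟩ ⟨(j | v' | w'), hy⟩ hxy
      · intro h
        have := hg h
        simp only [Subtype.mk.injEq] at this
        simp [this] at hxy
      · exact (hgL _).2.1
      · exact (hgL _).2.2
      · exact Ne.symm (hgL _).2.1
      · simp at hxy
      · exact hne.symm
      · exact Ne.symm (hgL _).2.2
      · exact hne
      · simp at hxy
  obtain ⟨h, hhL, hh⟩ := key
  refine ⟨Coloring.mk (fun x => if hx : x ∈ X then h ⟨x, hx⟩ else f ⟨x, hx⟩) ?_, ?_⟩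
  · have hmix : ∀ x y, f x ≠ h y := fun x y e =>
      (Finset.mem_sdiff.1 (hfL x)).2 (e ▸ Finset.mem_biUnion.2 ⟨y, y.2, hhL y⟩)
    intro x y hxy
    by_cases hx : x ∈ X <;> by_cases hy : y ∈ X <;> simp only [hx, hy, dite_true, dite_false]
    · exact hh ⟨x, hx⟩ ⟨y, hy⟩ hxy
    · exact (hmix _ _).symm
    · exact hmix _ _
    · exact fun e => hxy.ne (by simpa using hf e)
  · intro x
    change (if hx : x ∈ X then h ⟨x, hx⟩ else f ⟨x, hx⟩) ∈ L x
    split_ifs with hx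
    · exact hhL ⟨x, hx⟩
    · exact (Finset.mem_sdiff.1 (hfL ⟨x, hx⟩)).1

end Hall

end SimpleGraph

namespace SimpleGraph

/-! ### The bad list assignment. -/

section BadLists

open Finset

/-- The colors `c < k` in the small residue classes, those which contain only `k / m` of the numbers
`0, …, k - 1`. -/
def smallResidues (k m : ℕ) : Finset ℕ := (range k).filter fun c => k % m ≤ c % m

lemma div_lt_of_mem_smallResidues {k m c : ℕ} (hc : c ∈ smallResidues k m) :
    c / m < k / m := by
  simp only [smallResidues, mem_filter, mem_range] at hc
  have h1 := Nat.div_add_mod c m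
  have h2 := Nat.div_add_mod k m
  by_contra! h
  have := Nat.mul_le_mul_left m h
  omega

/-- There are `m - k % m` short classes with `k / m` elements each; `(x, y)` indexes the `y`-th
element of class `k % m + x`. -/
lemma le_card_smallResidues {k m : ℕ} (hm : 0 < m) :
    ((1 + k / m) * m - k) * (k / m) ≤ (smallResidues k m).card := by
  have hk := Nat.div_add_mod k m
  have hlt := Nat.mod_lt k hm
  have hr : (1 + k / m) * m - k = m - k % m := by
    rw [add_mul, one_mul, mul_comm (k / m)]
    omega
  have hinj : Set.InjOn (fun p : ℕ × ℕ => p.2 * m + (k % m + p.1))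
      (range (m - k % m) ×ˢ range (k / m) : Finset (ℕ × ℕ)) := by
    rintro ⟨x, y⟩ hp ⟨x', y'⟩ hp' h
    simp only [coe_product, coe_range, Set.mem_prod, Set.mem_Iio] at hp hp'
    have e : ∀ x y, x < m - k % m → (y * m + (k % m + x)) / m = y := fun x y hx => by
      rw [mul_comm, Nat.mul_add_div hm, Nat.div_eq_of_lt (by omega), add_zero]
    have hy : y = y' := by
      rw [← e x y hp.1, ← e x' y' hp'.1]
      exact congrArg (· / m) h
    subst hy
    simp only [Prod.mk.injEq, and_true]
    simp only at h
    omega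
  rw [hr]
  calc (m - k % m) * (k / m) = (range (m - k % m) ×ˢ range (k / m)).card := by simp
    _ = ((range (m - k % m) ×ˢ range (k / m)).image
        fun p : ℕ × ℕ => p.2 * m + (k % m + p.1)).card := (card_image_of_injOn hinj).symm
    _ ≤ _ := card_le_card ?_
  intro c
  simp only [mem_image, mem_product, mem_range, Prod.exists, smallResidues, mem_filter]
  rintro ⟨x, y, ⟨hx, hy⟩, rfl⟩
  have hmod : (y * m + (k % m + x)) % m = k % m + x := by
    rw [mul_comm, Nat.mul_add_mod, Nat.mod_eq_of_lt (by omega)]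
  refine ⟨?_, by omega⟩
  have := Nat.mul_le_mul_left m (Nat.succ_le_of_lt hy)
  rw [Nat.mul_succ, mul_comm] at this
  omega

/-- The list of the `i`-th vertex on the small side. The colors `(0, c)` with `c < k` are the base
colors; for `i < m` the base colors of residue `i` are replaced by new ones `(1, d)` with
`d ≤ k / m`; the vertex `m` has all base colors; the remaining vertices have private lists. -/
def smallSideList (k m i : ℕ) : Finset (ℕ × ℕ) :=
  (range k).image fun c =>
    if i < m then if c % m = i then (1, c / m) else (0, c)
    else if i = m then (0, c) else (i - m + 1, c)

/-- Within one residue class, `c` is determined by `c / m`, so replacing colors loses none. -/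
lemma card_smallSideList {k m i : ℕ} : (smallSideList k m i).card = k := by
  rw [smallSideList, card_image_of_injective, card_range]
  intro c c' h
  have h1 := Nat.div_add_mod c m
  have h2 := Nat.div_add_mod c' m
  simp only at h
  split_ifs at h with h3 h4 h5 h5 h4
  · simp only [Prod.mk.injEq, true_and] at h
    rw [← h1, ← h2, h, h4, h5]
  all_goals simp at h
  all_goals exact h

/-- The lists on the large side, without their private parts: the `(l + 1)`-sets of base colors
and the `l`-sets of base colors together with one new color, except for those of the latter which
are not needed. -/
def largeSideBase (k m l : ℕ) : Finset (Finset (ℕ × ℕ)) :=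
  (powersetCard (l + 1) (range k)).image (fun S => S.image (Prod.mk 0)) ∪
    ((powersetCard l (range k) ×ˢ range (k / m + 1)) \
      (powersetCard l (smallResidues k m) ×ˢ {k / m})).image
        fun p => insert (1, p.2) (p.1.image (Prod.mk 0))

lemma card_largeSideBase_le {k m l : ℕ} :
    (largeSideBase k m l).card ≤
      k.choose (l + 1) + k.choose l * (k / m + 1) - (smallResidues k m).card.choose l := by
  have hsub : powersetCard l (smallResidues k m) ×ˢ {k / m} ⊆
      powersetCard l (range k) ×ˢ range (k / m + 1) :=
    product_subset_product (powersetCard_mono (filter_subset _ _)) (by simp)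
  have h1 := card_union_le ((powersetCard (l + 1) (range k)).image fun S => S.image (Prod.mk 0))
    (((powersetCard l (range k) ×ˢ range (k / m + 1)) \
      (powersetCard l (smallResidues k m) ×ˢ {k / m})).image
        fun p => insert (1, p.2) (p.1.image (Prod.mk 0)))
  have h2 := card_image_le (s := powersetCard (l + 1) (range k))
    (f := fun S => S.image (Prod.mk 0))
  have h3 := card_image_le (s := (powersetCard l (range k) ×ˢ range (k / m + 1)) \
      (powersetCard l (smallResidues k m) ×ˢ {k / m}))
    (f := fun p => insert (1, p.2) (p.1.image (Prod.mk 0)))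
  -- Keeps the truncated subtraction honest: no more pairs are omitted than exist.
  have h4 := card_le_card hsub
  rw [card_sdiff_of_subset hsub] at h3
  simp only [card_product, card_powersetCard, card_range, card_singleton, mul_one] at h2 h3 h4
  rw [largeSideBase]
  omega

lemma card_of_mem_largeSideBase {k m l : ℕ} {T : Finset (ℕ × ℕ)} (hT : T ∈ largeSideBase k m l) :
    T.card = l + 1 ∧ ∀ x ∈ T, x.1 < 2 := by
  have hinj : Function.Injective (Prod.mk (β := ℕ) 0) := Prod.mk_right_injective 0
  simp only [largeSideBase, mem_union, mem_image, mem_sdiff, mem_product, mem_powersetCard] at hT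
  rcases hT with ⟨S, hS, rfl⟩ | ⟨⟨S, d⟩, ⟨⟨hS, -⟩, -⟩, rfl⟩
  · refine ⟨by rw [card_image_of_injective _ hinj, hS.2], ?_⟩
    simp
  · refine ⟨?_, ?_⟩
    · rw [card_insert_of_notMem (by simp), card_image_of_injective _ hinj, hS.2]
    · simp

/-- The private part of a list on the large side: one color from each of `s` private lists. -/
def privatePart {k s : ℕ} (t : Fin s → Fin k) : Finset (ℕ × ℕ) :=
  univ.image fun j : Fin s => ((j : ℕ) + 2, (t j : ℕ))

lemma card_privatePart {k s : ℕ} (t : Fin s → Fin k) : (privatePart t).card = s := by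
  rw [privatePart, card_image_of_injective, card_univ, Fintype.card_fin]
  intro i j h
  simp only [Prod.mk.injEq] at h
  exact Fin.ext (by omega)

/-- All lists on the large side. -/
def largeSideLists (k m l s : ℕ) : Finset (Finset (ℕ × ℕ)) :=
  (largeSideBase k m l ×ˢ (univ : Finset (Fin s → Fin k))).image fun p => p.1 ∪ privatePart p.2

lemma card_largeSideLists_le {k m l s : ℕ} :
    (largeSideLists k m l s).card ≤ k ^ s * (largeSideBase k m l).card := by
  refine card_image_le.trans ?_
  simp [mul_comm]

lemma card_of_mem_largeSideLists {k m l s : ℕ} {T : Finset (ℕ × ℕ)}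
    (hT : T ∈ largeSideLists k m l s) : T.card = l + 1 + s := by
  simp only [largeSideLists, mem_image, mem_product, mem_univ, and_true] at hT
  obtain ⟨⟨T, t⟩, hT, rfl⟩ := hT
  obtain ⟨hcard, hlt⟩ := card_of_mem_largeSideBase hT
  rw [card_union_of_disjoint, hcard, card_privatePart]
  rw [Finset.disjoint_left]
  intro x hx hx'
  obtain ⟨j, -, rfl⟩ := mem_image.1 hx'
  have := hlt _ hx
  simp at this

/-- If the complete graph uses `n` base colors, then together with the colors on the small side
some base list on the large side is exhausted. -/
lemma exists_mem_largeSideBase_subset {k m n : ℕ} (hm : 0 < m) (g : Fin n → ℕ)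
    (hg : Function.Injective g) (hgk : ∀ i, g i < k) (f : ℕ → ℕ × ℕ)
    (hf : ∀ i ≤ m, f i ∈ smallSideList k m i) (hgf : ∀ j, ∀ i ≤ m, ((0, g j) : ℕ × ℕ) ≠ f i) :
    ∃ T ∈ largeSideBase k m (n + 1), ∀ x ∈ T, (∃ j, x = (0, g j)) ∨ ∃ i ≤ m, x = f i := by
  obtain ⟨c₀, hc₀k, hc₀⟩ : ∃ c < k, f m = (0, c) := by
    have := hf m le_rfl
    simp only [smallSideList, lt_irrefl, if_false, if_true, mem_image, mem_range] at this
    obtain ⟨c, hc, h⟩ := this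
    exact ⟨c, hc, h.symm⟩
  set S : Finset ℕ := insert c₀ (univ.image g) with hS
  have hSk : S ⊆ range k := by
    intro c
    simp only [hS, mem_insert, mem_image, mem_univ, true_and, mem_range]
    rintro (rfl | ⟨i, rfl⟩)
    · exact hc₀k
    · exact hgk i
  have hScard : S.card = n + 1 := by
    rw [hS, card_insert_of_notMem, card_image_of_injective _ hg, card_univ, Fintype.card_fin]
    simp only [mem_image, mem_univ, true_and, not_exists]
    intro j hj
    exact hgf j m le_rfl (by rw [hj, hc₀])
  have hSused : ∀ c ∈ S, (∃ j, ((0, c) : ℕ × ℕ) = (0, g j)) ∨ ∃ i ≤ m, ((0, c) : ℕ × ℕ) = f i := by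
    intro c
    simp only [hS, mem_insert, mem_image, mem_univ, true_and]
    rintro (rfl | ⟨j, rfl⟩)
    · exact Or.inr ⟨m, le_rfl, hc₀.symm⟩
    · exact Or.inl ⟨j, rfl⟩
  -- the vertex whose list misses `c₀`
  have hi₀ : c₀ % m < m := Nat.mod_lt _ hm
  have hfi := hf (c₀ % m) hi₀.le
  simp only [smallSideList, hi₀, if_true, mem_image, mem_range] at hfi
  obtain ⟨c, hck, hfc⟩ := hfi
  split_ifs at hfc with hcm
  · refine ⟨insert (1, c / m) (S.image (Prod.mk 0)), mem_union_right _ ?_, ?_⟩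
    · refine mem_image.2 ⟨(S, c / m), mem_sdiff.2 ⟨?_, fun h => ?_⟩, rfl⟩
      · exact mem_product.2 ⟨mem_powersetCard.2 ⟨hSk, hScard⟩,
          mem_range.2 (Nat.lt_succ_of_le (Nat.div_le_div_right hck.le))⟩
      · simp only [mem_product, mem_powersetCard, mem_singleton] at h
        -- `c` has the residue of `c₀`, so if `S` lies in short classes then `c` does too and `c / m
        -- < k / m`: the pair is not an omitted one.
        have hc₀U := (mem_filter.1 (h.1.1 (mem_insert_self c₀ _))).2
        have hcU : c ∈ smallResidues k m := mem_filter.2 ⟨mem_range.2 hck, by omega⟩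
        exact (div_lt_of_mem_smallResidues hcU).ne h.2
    · simp only [mem_insert, mem_image]
      rintro x (rfl | ⟨c', hc', rfl⟩)
      · exact Or.inr ⟨_, hi₀.le, hfc⟩
      · exact hSused c' hc'
  -- `c` differs from `c₀` in residue and from the clique colors by adjacency.
  · have hcS : c ∉ S := by
      simp only [hS, mem_insert, mem_image, mem_univ, true_and, not_or, not_exists]
      refine ⟨fun h => hcm (by rw [h]), fun j hj => hgf j _ hi₀.le ?_⟩
      rw [← hfc, hj]
    refine ⟨(insert c S).image (Prod.mk 0), ?_, ?_⟩
    · refine mem_union_left _ (mem_image_of_mem _ (mem_powersetCard.2 ⟨?_, ?_⟩))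
      · exact insert_subset (mem_range.2 hck) hSk
      · rw [card_insert_of_notMem hcS, hScard]
    · simp only [mem_image, mem_insert]
      rintro x ⟨c', rfl | hc', rfl⟩
      · exact Or.inr ⟨_, hi₀.le, hfc⟩
      · exact hSused c' hc'

/-- If the large side of `K_{a,b}` is large, then `K_n ∨ K_{a,b}` is not `(n + s + 2)`-choosable. -/
lemma not_colorableFromLists_completeGraph_graphJoin {n s m b k : ℕ} (hm : 0 < m)
    (hk : k = n + s + 2)
    (hb : k ^ s * (k.choose (n + 2) + k.choose (n + 1) * (k / m + 1)
      - (((1 + k / m) * m - k) * (k / m)).choose (n + 1)) ≤ b) :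
    ¬ ((completeGraph (Fin n)).graphJoin
      (completeBipartiteGraph (Fin (m + s + 1)) (Fin b))).ColorableFromLists k := by
  intro h
  have hcard : (largeSideLists k m (n + 1) s).card ≤ Fintype.card (Fin b) := by
    rw [Fintype.card_fin]
    refine card_largeSideLists_le.trans (le_trans (Nat.mul_le_mul_left _ ?_) hb)
    refine card_largeSideBase_le.trans (Nat.sub_le_sub_left ?_ _)
    exact Nat.choose_le_choose _ (le_card_smallResidues hm)
  rw [← Fintype.card_coe] at hcard
  obtain ⟨e⟩ := Function.Embedding.nonempty_of_card_le hcard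
  -- Surplus vertices of the large side get an arbitrary `k`-list.
  let LB : Fin b → Finset (ℕ × ℕ) :=
    Function.extend e (fun T => T.1) fun _ => (range k).image (Prod.mk 0)
  have hinj : Function.Injective (Prod.mk (β := ℕ) 0) := Prod.mk_right_injective 0
  have hLB : ∀ w, (LB w).card = k := by
    intro w
    by_cases hw : ∃ T, e T = w
    · obtain ⟨T, rfl⟩ := hw
      simp only [LB, e.injective.extend_apply]
      rw [card_of_mem_largeSideLists T.2]
      omega
    · simp only [LB, Function.extend_apply' _ _ _ hw]
      rw [card_image_of_injective _ hinj, card_range]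
  have := h (ℕ × ℕ) (Sum.elim (fun _ => (range k).image (Prod.mk 0))
    (Sum.elim (fun i : Fin (m + s + 1) => smallSideList k m i) LB)) (by
      rintro (i | i | w)
      · simp [card_image_of_injective _ hinj]
      · simp [card_smallSideList]
      · simp [hLB])
  rw [listColorable_completeGraph_graphJoin_iff] at this
  obtain ⟨g, f, hg, hgf, hgL, hfL⟩ := this
  have hfA : ∀ i : Fin (m + s + 1), f (Sum.inl i) ∈ smallSideList k m i :=
    fun i => hfL (Sum.inl i)
  have hfB : ∀ w, f (Sum.inr w) ∈ LB w := fun w => hfL (Sum.inr w)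
  simp only [Sum.elim_inl, mem_image, mem_range] at hgL
  choose g' hg'k hg' using hgL
  obtain ⟨T, hT, hTused⟩ := exists_mem_largeSideBase_subset (k := k) hm g'
    (fun i j hij => hg (by rw [← hg', ← hg', hij])) hg'k
    (fun i => f (Sum.inl (Fin.ofNat _ i))) (fun i hi => by
      have := hfA (Fin.ofNat _ i)
      rwa [Fin.val_ofNat, Nat.mod_eq_of_lt (by omega)] at this)
    (fun j i _ => by rw [hg']; exact hgf _ _)
  have ht : ∀ j : Fin s, ∃ x : Fin k,
      f (Sum.inl ⟨m + 1 + j, by omega⟩) = ((j : ℕ) + 2, (x : ℕ)) := by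
    intro j
    have := hfA ⟨m + 1 + j, by omega⟩
    simp only [smallSideList, mem_image, mem_range] at this
    obtain ⟨c, hc, hfc⟩ := this
    rw [if_neg (by omega), if_neg (by omega)] at hfc
    exact ⟨⟨c, hc⟩, by rw [← hfc]; simp only [Prod.mk.injEq, and_true]; omega⟩
  choose t ht using ht
  -- All colors of this list are used on the clique or the small side, so its large-side vertex has
  -- none left.
  have hmem : T ∪ privatePart t ∈ largeSideLists k m (n + 1) s :=
    mem_image.2 ⟨(T, t), by simp [hT], rfl⟩
  have hw := hfB (e ⟨_, hmem⟩)
  simp only [LB, e.injective.extend_apply, mem_union] at hw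
  have hAB : ∀ i w, f (Sum.inl i) ≠ f (Sum.inr w) := fun i w => f.valid (by simp)
  rcases hw with hw | hw
  · rcases hTused _ hw with ⟨j, hj⟩ | ⟨i, -, hi⟩
    · exact hgf j _ (by rw [hj, hg'])
    · exact hAB _ _ hi.symm
  · obtain ⟨j, -, hj⟩ := mem_image.1 hw
    exact hAB _ _ ((ht j).trans hj)

end BadLists

end SimpleGraph

/-! ### The lower bound on `τ_s(a,b)`. -/

theorem mainTheorem7 (s l a b q u : ℕ) (hl : 2 ≤ l) (ha : s + 2 < a)
    (hdvd : ¬ (a - s - 1) ∣ (l + s + 1))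
    (hq : q = (l + s + 1) / (a - s - 1))
    (hu : u = ((1 + q) * (a - s - 1) - (l + s + 1)) * q)
    (hab : a ≤ b)
    (hb : (l + s + 1) ^ s *
        ((l + s + 1).choose (l + 1) + (l + s + 1).choose l * (q + 1) - u.choose l) ≤ b) :
    l ≤ ohbaTau s a b := by
  obtain ⟨m, rfl⟩ : ∃ m, a = m + s + 1 := ⟨a - s - 1, by omega⟩
  obtain ⟨n, rfl⟩ : ∃ n, l = n + 1 := ⟨l - 1, by omega⟩
  have hm : m + s + 1 - s - 1 = m := by omega
  rw [hm] at hq hu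
  subst hq hu
  have : Nonempty (Fin b) := ⟨⟨0, by omega⟩⟩
  -- Nonemptiness matters: the infimum of the empty set in `ℕ` is `0`.
  refine le_csInf ⟨(m + s + 1 + b) ^ 2, ?_⟩ fun j hj => ?_
  · have h := SimpleGraph.listChromaticNumber_le_coe_iff.2
      (SimpleGraph.colorableFromLists_completeGraph_graphJoin_completeBipartiteGraph
        ((m + s + 1 + b) ^ 2) (Fin (m + s + 1)) (Fin b) (by simp))
    rw [Set.mem_ofPred_eq,
      SimpleGraph.chromaticNumber_completeGraph_graphJoin_completeBipartiteGraph]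
    exact (tsub_eq_zero_of_le h).trans_le zero_le
  · rw [Set.mem_ofPred_eq,
      SimpleGraph.chromaticNumber_completeGraph_graphJoin_completeBipartiteGraph,
      tsub_le_iff_right, ← Nat.cast_add, SimpleGraph.listChromaticNumber_le_coe_iff] at hj
    by_contra! hlt
    -- Choosability with `j < l` clique vertices would lift to `n = l - 1` of them, with lists of
    -- size `k`.
    have h := hj.completeGraph_add_graphJoin (n - j)
    rw [show j + (n - j) = n by omega, show s + (j + 2) + (n - j) = n + 1 + s + 1 by omega] at h
    exact SimpleGraph.not_colorableFromLists_completeGraph_graphJoin (by omega) (by omega) hb h
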